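/- **Setting.** Let $f,g_1,\dots,g_m:\mathbb R^n\to\mathbb R^n$ with $f(0)=0$, let $\mathbb X\subseteq\mathbb R^n$ and $\mathbb U\subseteq\mathbb R^m$ be compact with $0\in\operatorname{int}\mathbb U$, and let $\Delta t>0$. Assume that for every $\hat x\in\mathbb X$ and every constant input $u\in\mathbb U\cup\{0,e_1,\dots,e_m\}$ the system $\dot x=f(x)+\sum_{i=1}^m u_i g_i(x)$, $x(0)=\hat x$, has exactly one solution $x(\cdot;\hat x,u)$ on $[0,\Delta t]$. The Koopman operator is $(\mathcal K^u_{\Delta t}\varphi)(\hat x)=\varphi(x(\Delta t;\hat x,u))$. The sampled system with feedback $\mu$ is $x_{k+1}=x(\Delta t;x_k,\mu(x_k))=x_k+\int_{0}^{\Delta t}\big(f(x(t))+\sum_i g_i(x(t))\,\mu(x_k)_i\big)\,dt$ with $x(t)=x(t;x_k,\mu(x_k))$. Let $N\ge n$, let $\phi_{n+1},\dots,\phi_N\in C^1(\mathbb R^n,\mathbb R)$ vanish at $0$, and put $\hat\Phi(x)=(x^\top,\phi_{n+1}(x),\dots,\phi_N(x))^\top\in\mathbb R^N$ and $\Phi(x)=(1,\hat\Phi(x)^\top)^\top$.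 All vector norms are Euclidean. **Data and surrogate.** For each $\bar u\in\{0,e_1,\dots,e_m\}$ let $x^{\bar u}_1,x^{\bar u}_2,\dots$ be i.i.d. samples from $\mathbb X$ with successors $y^{\bar u}_j=x(\Delta t;x_j^{\bar u},\bar u)$. From the first $d$ samples for each $\bar u$, let $A\in\mathbb R^{N\times N}$ minimize $\sum_{j\le d}\|\hat\Phi(y^0_j)-A\hat\Phi(x^0_j)\|^2$ and let $[\,b_{0,i}\ \ \hat B_i\,]\in\mathbb R^{N\times(1+N)}$ minimize $\sum_{j\le d}\|\hat\Phi(y^{e_i}_j)-[\,b_{0,i}\ \ \hat B_i\,]\Phi(x^{e_i}_j)\|^2$, $i=1,\dots,m$. Set $B_0=[\,b_{0,1}\cdots b_{0,m}\,]$, $\tilde B=[\,\hat B_1-A\ \cdots\ \hat B_m-A\,]$, $$\mathcal K^0_{\Delta t,d}=\begin{bmatrix}1&0\\0&A\end{bmatrix},\qquad \mathcal K^{e_i}_{\Delta t,d}=\begin{bmatrix}1&0\\b_{0,i}&\hat B_i\end{bmatrix},\qquad \mathcal K^u_{\Delta t,d}=\mathcal K^0_{\Delta t,d}+\sum_{i=1}^m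 u_i(\mathcal K^{e_i}_{\Delta t,d}-\mathcal K^0_{\Delta t,d}).$$ **Error bound.** Let $\delta\in(0,1)$ and $c_x,c_u>0$ be such that, for all sufficiently large $d$, with probability at least $1-\delta$, $$\|(\mathcal K^u_{\Delta t}\Phi)(x)-\mathcal K^u_{\Delta t,d}\Phi(x)\|\le c_x\|\Phi(x)-\Phi(0)\|+c_u\|u\|\qquad\text{for all }x\in\mathbb X,\ u\in\mathbb U.$$ **Design.** Let $Q_z\in\mathbb R^{N\times N}$ with $Q_z=Q_z^\top\prec0$, $s_z\in\mathbb R^N$, $r_z>0$, and $\begin{bmatrix}\tilde Q_z&\tilde s_z\\\tilde s_z^\top&\tilde r_z\end{bmatrix}=\begin{bmatrix}Q_z&s_z\\s_z^\top&r_z\end{bmatrix}^{-1}$. For $P=P^\top\in\mathbb R^{N\times N}$, $L\in\mathbb R^{m\times N}$, $L_w\in\mathbb R^{m\times Nm}$, $\Lambda=\Lambda^\top\in\mathbb R^{m\times m}$, $\nu,\tau\in\mathbb R$ consider $$\begin{bmatrix} P-\tau I_N & -\tilde B(\Lambda\otimes\tilde s_z)-B_0L_w(I_m\otimes\tilde s_z)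 & 0 & AP+B_0L & \tilde B(\Lambda\otimes I_N)+B_0L_w\\ \star & \tilde r_z\Lambda-L_w(I_m\otimes\tilde s_z)-(I_m\otimes\tilde s_z^\top)L_w^\top & -(I_m\otimes\tilde s_z^\top)\begin{bmatrix}0\\L_w\end{bmatrix}^\top & L & L_w\\ \star&\star&\tfrac{\tau}{2}\begin{bmatrix}c_x^{-2}I_N&0\\0&c_u^{-2}I_m\end{bmatrix}&\begin{bmatrix}P\\L\end{bmatrix}&\begin{bmatrix}0\\L_w\end{bmatrix}\\ \star&\star&\star&P&0\\ \star&\star&\star&\star&-(\Lambda\otimes\tilde Q_z^{-1}) \end{bmatrix}\succ0,\tag{1}$$ $$\begin{bmatrix}\nu\tilde r_z-1&-\nu\tilde s_z^\top\\-\nu\tilde s_z&\nu\tilde Q_z+P\end{bmatrix}\preceq0,\tag{2}$$ and put $$\mu(x)=\big(I-L_w(\Lambda^{-1}\otimes\hat\Phi(x))\big)^{-1}LP^{-1}\hat\Phi(x),\qquad \mathcal X_{\mathrm{RoA}}=\{x\in\mathbb R^n:\hat\Phi(x)^\top P^{-1}\hat\Phi(x)\le1\}.$$ **Theorem.** There is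 $d_0\in\mathbb N$ such that for all $d\ge d_0$, with probability at least $1-\delta$, the following holds. Whenever $P\succ0$, $L$, $L_w$, $\Lambda\succ0$, $\nu>0$, $\tau>0$ satisfy (1) and (2) for the surrogate learned from $d$ samples, and $\mathcal X_{\mathrm{RoA}}\subseteq\mathbb X$ and $\mu(\mathcal X_{\mathrm{RoA}})\subseteq\mathbb U$, then the inverse in $\mu(x)$ exists for all $x\in\mathcal X_{\mathrm{RoA}}$, and $\mu$ exponentially stabilizes the sampled system on $\mathcal X_{\mathrm{RoA}}$: there are $C\ge1$ and $\sigma\in(0,1)$ such that for every $\hat x\in\mathcal X_{\mathrm{RoA}}$ the closed-loop trajectory with $x_0=\hat x$ exists for all $k\ge 0$ and satisfies $\|x_k\|\le C\sigma^k\|\hat x\|$. -/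

import Mathlib

open MeasureTheory ProbabilityTheory
open scoped Matrix Kronecker

namespace SafEDMD

/-- Euclidean space `ℝᵏ`. -/
abbrev E (k : ℕ) : Type := EuclideanSpace ℝ (Fin k)

/-- Index set of the `N = n + q` non-constant observables: the `n` state coordinates,
followed by `q` further observables. -/
abbrev Obs (n q : ℕ) : Type := Fin n ⊕ Fin q

/-- Index set of all `N + 1` observables, the constant one first. -/
abbrev Obs₁ (n q : ℕ) : Type := Unit ⊕ Obs n q

/-- Euclidean norm of a coordinate vector. -/
noncomputable def l2norm {ι : Type*} [Fintype ι] (v : ι → ℝ) : ℝ :=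
  ‖WithLp.toLp 2 v‖

/-- Frobenius norm. -/
noncomputable def frobNorm {ι κ : Type*} [Fintype ι] [Fintype κ] (M : Matrix ι κ ℝ) : ℝ :=
  Real.sqrt (∑ i, ∑ j, M i j ^ 2)

/-! ### The control system, its flow under constant inputs, and the Koopman operator -/

section System

variable {n m : ℕ}

/-- The control-affine vector field `f(x) + ∑ᵢ uᵢ gᵢ(x)`. -/
noncomputable def vectorField (f : E n → E n) (g : Fin m → E n → E n) (x : E n) (u : E m) :
    E n :=
  f x + ∑ i, u i • g i x

/-- `ξ` solves `ẋ = f(x) + ∑ᵢ uᵢ gᵢ(x)`, `x(0) = x₀`, on `[0, T]` for the constant input `u`. -/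
def IsSolution (f : E n → E n) (g : Fin m → E n → E n) (u : E m) (T : ℝ) (x₀ : E n)
    (ξ : ℝ → E n) : Prop :=
  ContinuousOn ξ (Set.Icc 0 T) ∧
    IntervalIntegrable (fun s => vectorField f g (ξ s) u) volume 0 T ∧
    ∀ t ∈ Set.Icc (0 : ℝ) T, ξ t = x₀ + ∫ s in (0 : ℝ)..t, vectorField f g (ξ s) u

/-- The initial value problem with constant input `u` has exactly one solution on `[0, T]`. -/
def WellPosed (f : E n → E n) (g : Fin m → E n → E n) (u : E m) (T : ℝ) (x₀ : E n) : Prop :=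
  ∃ ξ, IsSolution f g u T x₀ ξ ∧
    ∀ η, IsSolution f g u T x₀ η → Set.EqOn η ξ (Set.Icc 0 T)

open Classical in
/-- `x(T; x₀, u)` for the constant input `u` (only meaningful where a solution exists). -/
noncomputable def flow (f : E n → E n) (g : Fin m → E n → E n) (T : ℝ) (x₀ : E n) (u : E m) :
    E n :=
  if h : ∃ ξ, IsSolution f g u T x₀ ξ then h.choose T else x₀

/-- The Koopman operator of the constant input `u`, acting on observables. -/
noncomputable def koopman (f : E n → E n) (g : Fin m → E n → E n) (T : ℝ) (u : E m)
    (φ : E n → ℝ) : E n → ℝ :=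
  fun x => φ (flow f g T x u)

/-- `x₀, x₁, …` is a trajectory of the sampled system
`x_{k+1} = x_k + ∫ f(x(t)) + ∑ᵢ gᵢ(x(t)) (u_k)ᵢ dt` (integral over one sampling period)
in closed loop with the sampled-and-held feedback `u_k = μ(x_k)`. -/
def IsSampledTrajectory (f : E n → E n) (g : Fin m → E n → E n) (T : ℝ) (μ : E n → E m)
    (x : ℕ → E n) : Prop :=
  ∀ k, ∃ ξ, IsSolution f g (μ (x k)) T (x k) ξ ∧ x (k + 1) = ξ T

/-- Exponential stability of the origin for the sampled closed loop, for all initial conditions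
in `S`: closed-loop trajectories exist for all times and decay exponentially, uniformly on `S`. -/
def SampledExpStableOn (f : E n → E n) (g : Fin m → E n → E n) (T : ℝ) (μ : E n → E m)
    (S : Set (E n)) : Prop :=
  ∃ C : ℝ, 1 ≤ C ∧ ∃ σ : ℝ, 0 < σ ∧ σ < 1 ∧ ∀ x₀ ∈ S,
    (∃ x : ℕ → E n, x 0 = x₀ ∧ IsSampledTrajectory f g T μ x) ∧
    ∀ x : ℕ → E n, x 0 = x₀ → IsSampledTrajectory f g T μ x →
      ∀ k, ‖x k‖ ≤ C * σ ^ k * ‖x₀‖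

end System

/-! ### Observables -/

section Lifting

variable {n q : ℕ}

/-- Reduced observables `Φ̂(x) = (x, φ₁(x), …, φ_q(x))`. -/
def liftHat (φ : Fin q → E n → ℝ) (x : E n) : Obs n q → ℝ :=
  Sum.elim (fun i => x i) (fun j => φ j x)

/-- All observables `Φ(x) = (1, Φ̂(x))`. -/
def lift (φ : Fin q → E n → ℝ) (x : E n) : Obs₁ n q → ℝ :=
  Sum.elim (fun _ => 1) (liftHat φ x)

end Lifting

/-! ### The learning architecture -/

section Learning

variable {n m q : ℕ}

/-- The inputs applied for data collection: `0` and the unit vectors. -/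
noncomputable def testInput : Option (Fin m) → E m
  | none => 0
  | some i => EuclideanSpace.single i 1

/-- The matrices learned from data. -/
structure Surrogate (n m q : ℕ) where
  A : Matrix (Obs n q) (Obs n q) ℝ
  b₀ : Fin m → Obs n q → ℝ
  Bhat : Fin m → Matrix (Obs n q) (Obs n q) ℝ

/-- `B₀ = [b₀₁ ⋯ b₀ₘ]`. -/
def Surrogate.B₀ (S : Surrogate n m q) : Matrix (Obs n q) (Fin m) ℝ :=
  Matrix.of fun l i => S.b₀ i l

/-- `B̃ = [B̂₁ - A ⋯ B̂ₘ - A]`, the columns being indexed by (block, column in the block). -/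
def Surrogate.Btilde (S : Surrogate n m q) : Matrix (Obs n q) (Fin m × Obs n q) ℝ :=
  Matrix.of fun l p => (S.Bhat p.1 - S.A) l p.2

/-- The surrogate of the Koopman operator of the zero input. -/
def Surrogate.K₀ (S : Surrogate n m q) : Matrix (Obs₁ n q) (Obs₁ n q) ℝ :=
  Matrix.fromBlocks 1 0 0 S.A

/-- The surrogate of the Koopman operator of the `i`-th unit vector. -/
def Surrogate.Kᵢ (S : Surrogate n m q) (i : Fin m) : Matrix (Obs₁ n q) (Obs₁ n q) ℝ :=
  Matrix.fromBlocks 1 0 (Matrix.replicateCol Unit (S.b₀ i)) (S.Bhat i)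

/-- The bilinear surrogate `K₀ + ∑ᵢ uᵢ (Kᵢ - K₀)`. -/
noncomputable def Surrogate.K (S : Surrogate n m q) (u : E m) :
    Matrix (Obs₁ n q) (Obs₁ n q) ℝ :=
  S.K₀ + ∑ i, u i • (S.Kᵢ i - S.K₀)

/-- Data matrix of the reduced observables, one column per sample. -/
def dataHat (φ : Fin q → E n → ℝ) {d : ℕ} (z : Fin d → E n) : Matrix (Obs n q) (Fin d) ℝ :=
  Matrix.of fun l j => liftHat φ (z j) l

/-- Data matrix of all observables, one column per sample. -/
def dataFull (φ : Fin q → E n → ℝ) {d : ℕ} (z : Fin d → E n) : Matrix (Obs₁ n q) (Fin d) ℝ :=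
  Matrix.of fun l j => lift φ (z j) l

/-- `S` solves the linear regression problems for the samples `x` with successors `y`. -/
def IsLearned (φ : Fin q → E n → ℝ) {d : ℕ} (x y : Option (Fin m) → Fin d → E n)
    (S : Surrogate n m q) : Prop :=
  (∀ A' : Matrix (Obs n q) (Obs n q) ℝ,
    frobNorm (dataHat φ (y none) - S.A * dataHat φ (x none)) ≤
      frobNorm (dataHat φ (y none) - A' * dataHat φ (x none))) ∧
  ∀ i : Fin m, ∀ (b' : Obs n q → ℝ) (B' : Matrix (Obs n q) (Obs n q) ℝ),
    frobNorm (dataHat φ (y (some i)) -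
        Matrix.fromCols (Matrix.replicateCol Unit (S.b₀ i)) (S.Bhat i) *
          dataFull φ (x (some i))) ≤
      frobNorm (dataHat φ (y (some i)) -
        Matrix.fromCols (Matrix.replicateCol Unit b') B' * dataFull φ (x (some i)))

/-- The proportional bound on the full approximation error, for all `x ∈ X`, `u ∈ U`. -/
def ErrorBound (f : E n → E n) (g : Fin m → E n → E n) (T : ℝ) (φ : Fin q → E n → ℝ)
    (X : Set (E n)) (U : Set (E m)) (c_x c_u : ℝ) (S : Surrogate n m q) : Prop :=
  ∀ x ∈ X, ∀ u ∈ U,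
    l2norm ((fun l => koopman f g T u (fun y => lift φ y l) x) - S.K u *ᵥ lift φ x) ≤
      c_x * l2norm (lift φ x - lift φ 0) + c_u * ‖u‖

end Learning

/-! ### The controller and the matrix inequalities -/

section Design

/-- Kronecker product `M ⊗ v` with a column vector `v`. -/
def kronCol {ι κ ρ : Type*} (M : Matrix ι κ ℝ) (v : ρ → ℝ) : Matrix (ι × ρ) κ ℝ :=
  (M ⊗ₖ Matrix.replicateCol Unit v).submatrix id (fun j => (j, ()))

/-- The symmetric block matrix `[[A, B], [⋆, D]]`. -/
def symBlocks {ι κ : Type*} (A : Matrix ι ι ℝ) (B : Matrix ι κ ℝ) (D : Matrix κ κ ℝ) :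
    Matrix (ι ⊕ κ) (ι ⊕ κ) ℝ :=
  Matrix.fromBlocks A B Bᵀ D

variable {n m q : ℕ}

/-- The inverse of `[[Q_z, s_z], [s_zᵀ, r_z]]`. -/
noncomputable def invZ (Qz : Matrix (Obs n q) (Obs n q) ℝ) (sz : Obs n q → ℝ) (rz : ℝ) :
    Matrix (Obs n q ⊕ Unit) (Obs n q ⊕ Unit) ℝ :=
  (symBlocks Qz (Matrix.replicateCol Unit sz) (Matrix.of fun _ _ => rz))⁻¹

/-- `Q̃_z`. -/
noncomputable def tQ (Qz : Matrix (Obs n q) (Obs n q) ℝ) (sz : Obs n q → ℝ) (rz : ℝ) :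
    Matrix (Obs n q) (Obs n q) ℝ :=
  (invZ Qz sz rz).toBlocks₁₁

/-- `s̃_z`. -/
noncomputable def ts (Qz : Matrix (Obs n q) (Obs n q) ℝ) (sz : Obs n q → ℝ) (rz : ℝ) :
    Obs n q → ℝ :=
  fun l => invZ Qz sz rz (Sum.inl l) (Sum.inr ())

/-- `r̃_z`. -/
noncomputable def tr (Qz : Matrix (Obs n q) (Obs n q) ℝ) (sz : Obs n q → ℝ) (rz : ℝ) : ℝ :=
  invZ Qz sz rz (Sum.inr ()) (Sum.inr ())

/-- The `5 × 5` block matrix of the stability condition, in terms of `Q̃`, `s̃`, `r̃`. -/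
noncomputable def stabilityMatrix (S : Surrogate n m q) (c_x c_u : ℝ)
    (Qt : Matrix (Obs n q) (Obs n q) ℝ) (st : Obs n q → ℝ) (rt : ℝ)
    (P : Matrix (Obs n q) (Obs n q) ℝ) (L : Matrix (Fin m) (Obs n q) ℝ)
    (Lw : Matrix (Fin m) (Fin m × Obs n q) ℝ) (Lam : Matrix (Fin m) (Fin m) ℝ) (τ : ℝ) :
    Matrix
      (Obs n q ⊕ (Fin m ⊕ ((Obs n q ⊕ Fin m) ⊕ (Obs n q ⊕ (Fin m × Obs n q)))))
      (Obs n q ⊕ (Fin m ⊕ ((Obs n q ⊕ Fin m) ⊕ (Obs n q ⊕ (Fin m × Obs n q))))) ℝ :=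
  let Is : Matrix (Fin m × Obs n q) (Fin m) ℝ := kronCol (1 : Matrix (Fin m) (Fin m) ℝ) st
  let Lw₀ : Matrix (Obs n q ⊕ Fin m) (Fin m × Obs n q) ℝ := Matrix.fromRows 0 Lw
  symBlocks
    (P - τ • (1 : Matrix (Obs n q) (Obs n q) ℝ))
    (Matrix.fromCols (-(S.Btilde * kronCol Lam st) - S.B₀ * Lw * Is)
      (Matrix.fromCols (0 : Matrix (Obs n q) (Obs n q ⊕ Fin m) ℝ)
        (Matrix.fromCols (S.A * P + S.B₀ * L)
          (S.Btilde * (Lam ⊗ₖ (1 : Matrix (Obs n q) (Obs n q) ℝ)) + S.B₀ * Lw))))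
    (symBlocks
      (rt • Lam - Lw * Is - Isᵀ * Lwᵀ)
      (Matrix.fromCols (-(Isᵀ * Lw₀ᵀ))
        (Matrix.fromCols L Lw))
      (symBlocks
        ((τ / 2) • Matrix.fromBlocks ((c_x ^ 2)⁻¹ • (1 : Matrix (Obs n q) (Obs n q) ℝ)) 0
          0 ((c_u ^ 2)⁻¹ • (1 : Matrix (Fin m) (Fin m) ℝ)))
        (Matrix.fromCols (Matrix.fromRows P L) Lw₀)
        (symBlocks P 0 (-(Lam ⊗ₖ Qt⁻¹)))))

/-- The matrix of the invariance condition, in terms of `Q̃`, `s̃`, `r̃`. -/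
def invarianceMatrix (Qt : Matrix (Obs n q) (Obs n q) ℝ) (st : Obs n q → ℝ) (rt : ℝ)
    (P : Matrix (Obs n q) (Obs n q) ℝ) (ν : ℝ) :
    Matrix (Unit ⊕ Obs n q) (Unit ⊕ Obs n q) ℝ :=
  symBlocks (Matrix.of fun _ _ => ν * rt - 1) (-(ν • Matrix.replicateRow Unit st)) (ν • Qt + P)

/-- `I - L_w (Λ⁻¹ ⊗ Φ̂(x))`. -/
noncomputable def controllerMatrix (φ : Fin q → E n → ℝ)
    (Lw : Matrix (Fin m) (Fin m × Obs n q) ℝ) (Lam : Matrix (Fin m) (Fin m) ℝ) (x : E n) :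
    Matrix (Fin m) (Fin m) ℝ :=
  1 - Lw * kronCol Lam⁻¹ (liftHat φ x)

/-- The feedback `μ(x) = (I - L_w (Λ⁻¹ ⊗ Φ̂(x)))⁻¹ L P⁻¹ Φ̂(x)`. -/
noncomputable def controller (φ : Fin q → E n → ℝ)
    (P : Matrix (Obs n q) (Obs n q) ℝ) (L : Matrix (Fin m) (Obs n q) ℝ)
    (Lw : Matrix (Fin m) (Fin m × Obs n q) ℝ) (Lam : Matrix (Fin m) (Fin m) ℝ) (x : E n) :
    E m :=
  WithLp.toLp 2 (((controllerMatrix φ Lw Lam x)⁻¹ * L * P⁻¹) *ᵥ liftHat φ x)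

/-- The region of attraction `{x | Φ̂(x)ᵀ P⁻¹ Φ̂(x) ≤ 1}`. -/
noncomputable def RoA (φ : Fin q → E n → ℝ) (P : Matrix (Obs n q) (Obs n q) ℝ) : Set (E n) :=
  {x | liftHat φ x ⬝ᵥ (P⁻¹ *ᵥ liftHat φ x) ≤ 1}

end Design

/-- `p` holds with probability at least `1 - δ`. -/
def HoldsWithProb {Ω : Type*} [MeasurableSpace Ω] (Pr : Measure Ω) (δ : ℝ) (p : Ω → Prop) :
    Prop :=
  ∃ G : Set Ω, MeasurableSet G ∧ ENNReal.ofReal (1 - δ) ≤ Pr G ∧ ∀ ω ∈ G, p ω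

end SafEDMD

open SafEDMD

namespace SafEDMD

/-! ### Quadratic forms -/

section QuadraticForms

/-! Probability enters only through the error bound: on the event where it holds, everything is
deterministic. The Lyapunov function is V(x) = zᵀP⁻¹z with z = Φ̂(x). Writing u = μ(x), λ = Λ⁻¹u and
z⁺ for the lifted successor, the feedback solves u = LP⁻¹z + L_w(λ ⊗ z), and z⁺ = Az + B₀u + B̃(u ⊗
z) + e with |e|² ≤ 2c_x²|z|² + 2c_u²|u|².

Instead of Schur complements and a dualized S-procedure, the matrix in (1) is evaluated at one
explicit vector (`dotProduct_stabilityMatrix_mulVec`). The result is at most V(x) - V(x⁺) -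
(λᵀu)·`formZ` z (`lyapunov_decrease`). Here λᵀu ≥ 0 since Λ ≻ 0, and (2) gives `formZ` z ≥ 0 on the
region of attraction (`formZ_nonneg_of_invariance`), so positive definiteness of (1) yields a strict
decrease proportional to |P⁻¹z|², hence to V. The same evaluation with most components zero shows
that the controller matrix has trivial kernel (`isUnit_controllerMatrix`).

The decrease keeps the sublevel set {V ≤ 1} invariant, so the error bound stays available at every
step. V is comparable to |x|² there because Φ̂ contains x and is linearly bounded on compact sets;
exponential decay follows. -/

lemma kronCol_mulVec {ι κ ρ : Type*} [Fintype κ] (M : Matrix ι κ ℝ) (v : ρ → ℝ) (a : κ → ℝ) :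
    kronCol M v *ᵥ a = fun p => (M *ᵥ a) p.1 * v p.2 := by
  ext p
  simp only [kronCol, Matrix.mulVec, dotProduct, Matrix.submatrix_apply, id,
    Matrix.kroneckerMap_apply, Matrix.replicateCol_apply, Finset.sum_mul]
  exact Finset.sum_congr rfl fun _ _ => by ring

variable {ι κ : Type*} [Fintype ι] [Fintype κ]

/-- Quadratic form of a symmetric `2 × 2` block matrix. -/
lemma dotProduct_symBlocks_mulVec (A : Matrix ι ι ℝ) (B : Matrix ι κ ℝ) (D : Matrix κ κ ℝ)
    (a : ι → ℝ) (b : κ → ℝ) :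
    Sum.elim a b ⬝ᵥ (symBlocks A B D *ᵥ Sum.elim a b) =
      a ⬝ᵥ (A *ᵥ a) + 2 * (a ⬝ᵥ (B *ᵥ b)) + b ⬝ᵥ (D *ᵥ b) := by
  have h : b ⬝ᵥ (Bᵀ *ᵥ a) = a ⬝ᵥ (B *ᵥ b) := by
    rw [Matrix.mulVec_transpose, dotProduct_comm, ← Matrix.dotProduct_mulVec]
  rw [symBlocks, Matrix.fromBlocks_mulVec, Sum.elim_comp_inl, Sum.elim_comp_inr,
    sumElim_dotProduct_sumElim, dotProduct_add, dotProduct_add, h]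
  ring

/-- The Kronecker product of two vectors. -/
def vecKron (a : ι → ℝ) (v : κ → ℝ) : ι × κ → ℝ := fun p => a p.1 * v p.2

lemma kronecker_mulVec_vecKron {ι' κ' : Type*} (M : Matrix ι' ι ℝ) (B : Matrix κ' κ ℝ)
    (a : ι → ℝ) (v : κ → ℝ) :
    (M ⊗ₖ B) *ᵥ vecKron a v = fun p => (M *ᵥ a) p.1 * (B *ᵥ v) p.2 := by
  ext p
  simp only [Matrix.mulVec, dotProduct, Matrix.kroneckerMap_apply, vecKron,
    Fintype.sum_prod_type, Finset.sum_mul_sum]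
  exact Finset.sum_congr rfl fun _ _ => Finset.sum_congr rfl fun _ _ => by ring

lemma vecKron_dotProduct_vecKron (a b : ι → ℝ) (v w : κ → ℝ) :
    vecKron a v ⬝ᵥ vecKron b w = (a ⬝ᵥ b) * (v ⬝ᵥ w) := by
  simp only [dotProduct, vecKron, Fintype.sum_prod_type, Finset.sum_mul_sum]
  exact Finset.sum_congr rfl fun _ _ => Finset.sum_congr rfl fun _ _ => by ring

lemma continuous_dotProduct_mulVec (M : Matrix ι ι ℝ) :
    Continuous fun v : ι → ℝ => v ⬝ᵥ (M *ᵥ v) := by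
  simp only [dotProduct, Matrix.mulVec]
  fun_prop

lemma dotProduct_mulVec_smul_smul (M : Matrix ι ι ℝ) (r : ℝ) (v : ι → ℝ) :
    (r • v) ⬝ᵥ (M *ᵥ (r • v)) = r ^ 2 * (v ⬝ᵥ (M *ᵥ v)) := by
  rw [Matrix.mulVec_smul, smul_dotProduct, dotProduct_smul, smul_eq_mul, smul_eq_mul]
  ring

/-- A quadratic form that is at least `c` on the unit sphere dominates `c ‖v‖²`. -/
lemma le_dotProduct_mulVec_of_sphere (M : Matrix ι ι ℝ) (c : ℝ)
    (h : ∀ v : ι → ℝ, ‖v‖ = 1 → c ≤ v ⬝ᵥ (M *ᵥ v)) (v : ι → ℝ) :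
    c * ‖v‖ ^ 2 ≤ v ⬝ᵥ (M *ᵥ v) := by
  rcases eq_or_ne v 0 with rfl | hv
  · simp
  have hn : ‖v‖ ≠ 0 := norm_ne_zero_iff.2 hv
  have h1 := h (‖v‖⁻¹ • v) (by rw [norm_smul, norm_inv, norm_norm, inv_mul_cancel₀ hn])
  rw [dotProduct_mulVec_smul_smul] at h1
  have h2 := mul_le_mul_of_nonneg_right h1 (sq_nonneg ‖v‖)
  calc c * ‖v‖ ^ 2 ≤ _ := h2
    _ = v ⬝ᵥ (M *ᵥ v) := by field_simp

/-- The form attains its minimum on the compact unit sphere of the sup norm. The constant is kept as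
a value of the form at some v₀ ≠ 0, so that positive definiteness makes it positive; applied to -M
it gives upper bounds. The sphere is empty when ι is, whence the first alternative. -/
lemma exists_le_dotProduct_mulVec (M : Matrix ι ι ℝ) :
    ∃ v₀ : ι → ℝ, (IsEmpty ι ∨ v₀ ≠ 0) ∧
      ∀ v : ι → ℝ, (v₀ ⬝ᵥ (M *ᵥ v₀)) * ‖v‖ ^ 2 ≤ v ⬝ᵥ (M *ᵥ v) := by
  rcases isEmpty_or_nonempty ι with hι | hι
  · exact ⟨0, Or.inl hι, fun v => by simp [Subsingleton.elim v 0]⟩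
  have hne : (Metric.sphere (0 : ι → ℝ) 1).Nonempty := NormedSpace.sphere_nonempty.2 zero_le_one
  obtain ⟨v₀, hv₀, hmin⟩ := (isCompact_sphere (0 : ι → ℝ) 1).exists_isMinOn hne
    (continuous_dotProduct_mulVec M).continuousOn
  refine ⟨v₀, Or.inr ?_, le_dotProduct_mulVec_of_sphere M _ fun v hv => hmin ?_⟩
  · rintro rfl
    simp at hv₀
  · simpa using hv

/-- A positive definite quadratic form is bounded below by a multiple of the squared norm. -/
lemma exists_pos_mul_sq_le (M : Matrix ι ι ℝ) (hM : M.PosDef) :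
    ∃ c > 0, ∀ v : ι → ℝ, c * ‖v‖ ^ 2 ≤ v ⬝ᵥ (M *ᵥ v) := by
  obtain ⟨v₀, h0, h⟩ := exists_le_dotProduct_mulVec M
  rcases h0 with hι | h0
  · exact ⟨1, one_pos, fun v => by simp [Subsingleton.elim v 0]⟩
  · exact ⟨_, by simpa using hM.dotProduct_mulVec_pos h0, h⟩

/-- A quadratic form is bounded above by a multiple of the squared norm. -/
lemma exists_le_mul_sq (M : Matrix ι ι ℝ) :
    ∃ c > 0, ∀ v : ι → ℝ, v ⬝ᵥ (M *ᵥ v) ≤ c * ‖v‖ ^ 2 := by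
  obtain ⟨v₀, -, h⟩ := exists_le_dotProduct_mulVec (-M)
  refine ⟨max 1 (-(v₀ ⬝ᵥ (-M *ᵥ v₀))), lt_max_of_lt_left one_pos, fun v => ?_⟩
  have h1 := h v
  have h2 := mul_le_mul_of_nonneg_right (le_max_right 1 (-(v₀ ⬝ᵥ (-M *ᵥ v₀)))) (sq_nonneg ‖v‖)
  rw [Matrix.neg_mulVec v M, dotProduct_neg] at h1
  linarith

lemma dotProduct_mulVec_nonneg_of_posSemidef {M : Matrix ι ι ℝ} (hM : M.PosSemidef) (v : ι → ℝ) :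
    0 ≤ v ⬝ᵥ (M *ᵥ v) := by
  simpa using hM.dotProduct_mulVec_nonneg v

lemma l2norm_sq (v : ι → ℝ) : l2norm v ^ 2 = v ⬝ᵥ v := by
  rw [l2norm, EuclideanSpace.norm_sq_eq]
  simp [dotProduct, pow_two]

lemma dotProduct_mulVec_comm_of_isSymm {M : Matrix ι ι ℝ} (hM : M.IsSymm) (v w : ι → ℝ) :
    v ⬝ᵥ (M *ᵥ w) = w ⬝ᵥ (M *ᵥ v) := by
  rw [Matrix.dotProduct_mulVec, ← Matrix.mulVec_transpose, hM, dotProduct_comm]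

end QuadraticForms

/-! ### The quadratic form of the stability matrix -/

section StabilityForm

variable {n m q : ℕ}

/-- The last component, λ ⊗ (αs̃ - z), is chosen so that its s̃-part cancels every term with B̃(Λ ⊗
s̃) or L_w(I ⊗ s̃), while its z-part, with -k, assembles Lk + L_w(λ ⊗ z) = u. What remains is the
bilinear prediction and a scalar multiplier times λᵀu. The other components stay free for the two
later uses. -/
lemma dotProduct_stabilityMatrix_mulVec (S : Surrogate n m q) (c_x c_u : ℝ)
    (Qt : Matrix (Obs n q) (Obs n q) ℝ) (st : Obs n q → ℝ) (rt : ℝ)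
    (P : Matrix (Obs n q) (Obs n q) ℝ) (L : Matrix (Fin m) (Obs n q) ℝ)
    (Lw : Matrix (Fin m) (Fin m × Obs n q) ℝ) (Lam : Matrix (Fin m) (Fin m) ℝ) (τ : ℝ)
    (p b k z : Obs n q → ℝ) (c lam u : Fin m → ℝ) (α : ℝ)
    (hu : Lam *ᵥ lam = u) (hfb : L *ᵥ k + Lw *ᵥ vecKron lam z = u)
    (v : Obs n q ⊕ (Fin m ⊕ ((Obs n q ⊕ Fin m) ⊕ (Obs n q ⊕ (Fin m × Obs n q)))) → ℝ)
    (hv : v = Sum.elim p (Sum.elim (α • lam) (Sum.elim (Sum.elim b c)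
      (Sum.elim (-k) (vecKron lam (α • st - z)))))) :
    v ⬝ᵥ (stabilityMatrix S c_x c_u Qt st rt P L Lw Lam τ *ᵥ v) =
      p ⬝ᵥ (P *ᵥ p) - τ * (p ⬝ᵥ p) + k ⬝ᵥ (P *ᵥ k)
        - 2 * (p ⬝ᵥ (S.A *ᵥ (P *ᵥ k) + S.B₀ *ᵥ u + S.Btilde *ᵥ vecKron u z))
        + (lam ⬝ᵥ u) *
          (rt * α ^ 2 - 2 * α - (α • st - z) ⬝ᵥ (Qt⁻¹ *ᵥ (α • st - z)))
        + τ / 2 * ((c_x ^ 2)⁻¹ * (b ⬝ᵥ b) + (c_u ^ 2)⁻¹ * (c ⬝ᵥ c))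
        - 2 * (b ⬝ᵥ (P *ᵥ k)) - 2 * (c ⬝ᵥ u) := by
  have hsub : vecKron lam (α • st - z) = α • vecKron lam st - vecKron lam z := by
    ext x; simp [vecKron]; ring
  have hK : (Lam ⊗ₖ (1 : Matrix (Obs n q) (Obs n q) ℝ)) *ᵥ vecKron lam (α • st - z)
      = α • vecKron u st - vecKron u z := by
    rw [kronecker_mulVec_vecKron, hu]
    ext x; simp [vecKron]; ring
  have hQ : (Lam ⊗ₖ Qt⁻¹) *ᵥ vecKron lam (α • st - z)
      = vecKron u (Qt⁻¹ *ᵥ (α • st - z)) := by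
    rw [kronecker_mulVec_vecKron, hu]; rfl
  have hLs : kronCol Lam st *ᵥ lam = vecKron u st := by
    rw [kronCol_mulVec, hu]; rfl
  have hIs : kronCol (1 : Matrix (Fin m) (Fin m) ℝ) st *ᵥ lam = vecKron lam st := by
    rw [kronCol_mulVec, Matrix.one_mulVec]; rfl
  have hT : ∀ (w : Fin m × Obs n q → ℝ),
      lam ⬝ᵥ ((kronCol (1 : Matrix (Fin m) (Fin m) ℝ) st)ᵀ *ᵥ w) = vecKron lam st ⬝ᵥ w := by
    intro w
    rw [Matrix.mulVec_transpose, dotProduct_comm, ← Matrix.dotProduct_mulVec, hIs,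
      dotProduct_comm]
  have hLwT : ∀ c : Fin m → ℝ, vecKron lam st ⬝ᵥ (Lwᵀ *ᵥ c) = c ⬝ᵥ (Lw *ᵥ vecKron lam st) := by
    intro c
    rw [Matrix.mulVec_transpose, dotProduct_comm, ← Matrix.dotProduct_mulVec]
  have hfb' : L *ᵥ k = u - Lw *ᵥ vecKron lam z := by rw [← hfb]; abel
  subst hv
  simp only [stabilityMatrix, dotProduct_symBlocks_mulVec, Matrix.fromCols_mulVec_sumElim,
    Matrix.fromRows_mulVec, Matrix.transpose_fromRows, Matrix.transpose_zero,
    sumElim_dotProduct_sumElim, Matrix.fromBlocks_mulVec, Sum.elim_comp_inl,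
    Sum.elim_comp_inr, Matrix.smul_mulVec,
    Matrix.sub_mulVec, Matrix.add_mulVec, Matrix.neg_mulVec, Matrix.one_mulVec,
    Matrix.zero_mulVec, Matrix.mulVec_smul, Matrix.mulVec_neg, ← Matrix.mulVec_mulVec, hK, hQ,
    hLs, hIs, hu, dotProduct_add, dotProduct_sub, dotProduct_neg, neg_dotProduct, dotProduct_zero,
    dotProduct_smul, smul_dotProduct, smul_eq_mul, hT, hLwT, hfb', vecKron_dotProduct_vecKron,
    Matrix.mulVec_sub, zero_add, add_zero]
  simp only [hsub, Matrix.mulVec_sub, Matrix.mulVec_smul, dotProduct_sub, dotProduct_smul,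
    smul_eq_mul]
  ring

end StabilityForm

/-! ### Blocks of size one -/

section UnitBlocks

variable {ι : Type*}

lemma replicateCol_mulVec_const (v : ι → ℝ) (c : ℝ) :
    Matrix.replicateCol Unit v *ᵥ (fun _ => c) = c • v := by
  ext l; simp [Matrix.mulVec, dotProduct, mul_comm]

lemma replicateRow_mulVec [Fintype ι] (v w : ι → ℝ) :
    Matrix.replicateRow Unit v *ᵥ w = fun _ => v ⬝ᵥ w := rfl

lemma of_const_mulVec_const (r c : ℝ) :
    (Matrix.of fun _ _ => r : Matrix Unit Unit ℝ) *ᵥ (fun _ => c) = fun _ => r * c := by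
  ext l; simp [Matrix.mulVec, dotProduct]

lemma const_dotProduct_const (a c : ℝ) : (fun _ : Unit => a) ⬝ᵥ (fun _ => c) = a * c := by
  simp [dotProduct]

end UnitBlocks

/-! ### The set of lifted states -/

section LiftedSet

variable {n q : ℕ}

/-- The matrix `[[Q_z, s_z], [s_zᵀ, r_z]]`. -/
def matZ (Qz : Matrix (Obs n q) (Obs n q) ℝ) (sz : Obs n q → ℝ) (rz : ℝ) :
    Matrix (Obs n q ⊕ Unit) (Obs n q ⊕ Unit) ℝ :=
  symBlocks Qz (Matrix.replicateCol Unit sz) (Matrix.of fun _ _ => rz)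

variable {Qz : Matrix (Obs n q) (Obs n q) ℝ} {sz : Obs n q → ℝ} {rz : ℝ}

lemma isSymm_of_posDef_neg (hQz : (-Qz).PosDef) : Qz.IsSymm := by
  have h := hQz.isHermitian.eq
  rw [Matrix.conjTranspose_eq_transpose_of_trivial, Matrix.transpose_neg] at h
  exact neg_injective h

lemma matZ_mulVec (y : Obs n q → ℝ) (t : ℝ) :
    matZ Qz sz rz *ᵥ Sum.elim y (fun _ => t) =
      Sum.elim (Qz *ᵥ y + t • sz) (fun _ => sz ⬝ᵥ y + rz * t) := by
  rw [matZ, symBlocks, Matrix.fromBlocks_mulVec, Sum.elim_comp_inl, Sum.elim_comp_inr]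
  rw [replicateCol_mulVec_const, of_const_mulVec_const, Matrix.transpose_replicateCol,
    replicateRow_mulVec]
  rfl

/-- A kernel vector (y, t) satisfies yᵀQ_z y = r_z t², and the two sides have opposite signs. -/
lemma isUnit_matZ (hQz : (-Qz).PosDef) (hrz : 0 < rz) : IsUnit (matZ Qz sz rz) := by
  rw [← Matrix.mulVec_injective_iff_isUnit, ← Matrix.coe_mulVecLin,
    injective_iff_map_eq_zero]
  intro k hk
  obtain ⟨y, t, rfl⟩ : ∃ (y : Obs n q → ℝ) (t : ℝ), k = Sum.elim y (fun _ => t) :=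
    ⟨k ∘ Sum.inl, k (Sum.inr ()), by ext (i | i) <;> rfl⟩
  rw [Matrix.coe_mulVecLin, matZ_mulVec] at hk
  have h1 : Qz *ᵥ y + t • sz = 0 := by
    ext l; exact congrFun hk (Sum.inl l)
  have h2 : sz ⬝ᵥ y + rz * t = 0 := congrFun hk (Sum.inr ())
  have h3 : y ⬝ᵥ (Qz *ᵥ y) + t * (sz ⬝ᵥ y) = 0 := by
    have := congrArg (y ⬝ᵥ ·) h1
    simpa [dotProduct_add, dotProduct_comm y sz] using this
  have hy : y = 0 := by
    by_contra hy
    have h4 : 0 < y ⬝ᵥ (-Qz *ᵥ y) := by simpa using hQz.dotProduct_mulVec_pos hy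
    rw [Matrix.neg_mulVec, dotProduct_neg] at h4
    have h5 : t * (sz ⬝ᵥ y) = -(rz * t ^ 2) := by linear_combination t * h2
    nlinarith [mul_nonneg hrz.le (sq_nonneg t)]
  subst hy
  have ht : t = 0 := by
    simpa [hrz.ne'] using h2
  subst ht
  ext (i | i) <;> rfl

lemma invZ_eq_symBlocks (hQz : (-Qz).PosDef) :
    invZ Qz sz rz = symBlocks (tQ Qz sz rz) (Matrix.replicateCol Unit (ts Qz sz rz))
      (Matrix.of fun _ _ => tr Qz sz rz) := by
  have hZ : (matZ Qz sz rz)ᵀ = matZ Qz sz rz := by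
    rw [matZ, symBlocks, Matrix.fromBlocks_transpose, isSymm_of_posDef_neg hQz]
    rfl
  have hW : (invZ Qz sz rz)ᵀ = invZ Qz sz rz := by
    change ((matZ Qz sz rz)⁻¹)ᵀ = (matZ Qz sz rz)⁻¹
    rw [Matrix.transpose_nonsing_inv, hZ]
  ext (i | i) (j | j)
  · rfl
  · rfl
  · exact (congrFun (congrFun hW (Sum.inr i)) (Sum.inl j)).symm
  · rfl

lemma matZ_mul_invZ_blocks (hQz : (-Qz).PosDef) (hrz : 0 < rz) :
    Qz * tQ Qz sz rz + Matrix.vecMulVec sz (ts Qz sz rz) = 1 ∧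
      Qz *ᵥ ts Qz sz rz = -(tr Qz sz rz • sz) ∧
      sz ᵥ* tQ Qz sz rz = -(rz • ts Qz sz rz) ∧
      sz ⬝ᵥ ts Qz sz rz = 1 - rz * tr Qz sz rz := by
  have h : matZ Qz sz rz * invZ Qz sz rz = 1 :=
    Matrix.mul_nonsing_inv _ ((Matrix.isUnit_iff_isUnit_det _).1 (isUnit_matZ hQz hrz))
  rw [invZ_eq_symBlocks hQz, matZ, symBlocks, symBlocks, Matrix.fromBlocks_multiply,
    ← Matrix.fromBlocks_one, Matrix.fromBlocks_inj] at h
  obtain ⟨h1, h2, h3, h4⟩ := h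
  refine ⟨?_, ?_, ?_, ?_⟩
  · rw [← h1]
    ext i j
    simp [Matrix.vecMulVec_apply, Matrix.mul_apply]
  · ext i
    have := congrFun (congrFun h2 i) ()
    simp [Matrix.mul_apply, Matrix.mulVec, dotProduct] at this ⊢
    linarith
  · ext i
    have := congrFun (congrFun h3 ()) i
    simp [Matrix.mul_apply, Matrix.vecMul, dotProduct] at this ⊢
    linarith
  · have := congrFun (congrFun h4 ()) ()
    simp [Matrix.mul_apply, dotProduct] at this ⊢
    linarith

/-- The inverse of a diagonal block of an inverse matrix is the Schur complement of the opposite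
block, here r_z. -/
lemma inv_tQ (hQz : (-Qz).PosDef) (hrz : 0 < rz) :
    (tQ Qz sz rz)⁻¹ = Qz - rz⁻¹ • Matrix.vecMulVec sz sz := by
  obtain ⟨h1, -, h3, -⟩ := matZ_mul_invZ_blocks (sz := sz) hQz hrz
  refine Matrix.inv_eq_left_inv ?_
  rw [Matrix.sub_mul, Matrix.smul_mul, Matrix.vecMulVec_mul, h3, ← h1]
  ext i j
  simp [Matrix.vecMulVec_apply]
  field_simp

/-- The quadratic function `[z; 1]ᵀ [[Q_z, s_z], [s_zᵀ, r_z]] [z; 1]`. -/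
def formZ (Qz : Matrix (Obs n q) (Obs n q) ℝ) (sz : Obs n q → ℝ) (rz : ℝ) (z : Obs n q → ℝ) : ℝ :=
  z ⬝ᵥ (Qz *ᵥ z) + 2 * (sz ⬝ᵥ z) + rz

/-- As a function of α the left side is a quadratic with leading coefficient 1/r_z > 0. The given α
is its minimizer, and the right side is its minimum. -/
lemma multiplier_eq_neg_formZ (hQz : (-Qz).PosDef) (hrz : 0 < rz) (z : Obs n q → ℝ) (α : ℝ)
    (hα : α = rz + sz ⬝ᵥ z) :
    tr Qz sz rz * α ^ 2 - 2 * α - (α • ts Qz sz rz - z) ⬝ᵥ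
      ((tQ Qz sz rz)⁻¹ *ᵥ (α • ts Qz sz rz - z)) = -formZ Qz sz rz z := by
  obtain ⟨-, h2, -, h4⟩ := matZ_mul_invZ_blocks (sz := sz) hQz hrz
  have h5 : ts Qz sz rz ⬝ᵥ (Qz *ᵥ z) = -(tr Qz sz rz * (sz ⬝ᵥ z)) := by
    rw [dotProduct_mulVec_comm_of_isSymm (isSymm_of_posDef_neg hQz), h2, dotProduct_neg,
      dotProduct_smul, dotProduct_comm, smul_eq_mul]
  have h6 : ∀ w, Matrix.vecMulVec sz sz *ᵥ w = (sz ⬝ᵥ w) • sz := by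
    intro w
    rw [Matrix.vecMulVec_mulVec]
    ext i
    simp [mul_comm]
  rw [inv_tQ hQz hrz, formZ]
  simp only [Matrix.sub_mulVec, Matrix.smul_mulVec, h6, Matrix.mulVec_sub, Matrix.mulVec_smul, h2,
    dotProduct_sub, sub_dotProduct, dotProduct_smul, smul_dotProduct, smul_eq_mul, h4, h5,
    dotProduct_neg, smul_sub, smul_neg, dotProduct_comm _ sz]
  subst hα
  field_simp
  ring

lemma mulVec_inv_mulVec {ι : Type*} [Fintype ι] [DecidableEq ι] {P : Matrix ι ι ℝ}
    (hP : P.PosDef) (z : ι → ℝ) : P *ᵥ (P⁻¹ *ᵥ z) = z := by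
  rw [Matrix.mulVec_mulVec, Matrix.mul_nonsing_inv _ ((Matrix.isUnit_iff_isUnit_det _).1 hP.isUnit),
    Matrix.one_mulVec]

/-- Cauchy–Schwarz for the dual norms of P⁻¹ and P: expand the nonnegative P-form at y - (zᵀy)P⁻¹z.
-/
lemma sq_dotProduct_le {ι : Type*} [Fintype ι] [DecidableEq ι] {P : Matrix ι ι ℝ} (hP : P.PosDef)
    {z : ι → ℝ} (hz : z ⬝ᵥ (P⁻¹ *ᵥ z) ≤ 1) (y : ι → ℝ) : (z ⬝ᵥ y) ^ 2 ≤ y ⬝ᵥ (P *ᵥ y) := by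
  have hPz : P *ᵥ (P⁻¹ *ᵥ z) = z := mulVec_inv_mulVec hP z
  have hsymm : P.IsSymm := by
    have := hP.isHermitian.eq
    rwa [Matrix.conjTranspose_eq_transpose_of_trivial] at this
  have h := dotProduct_mulVec_nonneg_of_posSemidef hP.posSemidef (y - (z ⬝ᵥ y) • (P⁻¹ *ᵥ z))
  have hc : P⁻¹ *ᵥ z ⬝ᵥ (P *ᵥ y) = z ⬝ᵥ y := by
    rw [dotProduct_mulVec_comm_of_isSymm hsymm, hPz, dotProduct_comm]
  simp only [Matrix.mulVec_sub, Matrix.mulVec_smul, hPz, dotProduct_sub, sub_dotProduct,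
    dotProduct_smul, smul_dotProduct, smul_eq_mul, hc, dotProduct_comm _ z] at h
  nlinarith [mul_le_mul_of_nonneg_left hz (sq_nonneg (z ⬝ᵥ y))]

/-- The invariance condition places the region of attraction in the set of lifted states. -/
lemma formZ_nonneg_of_invariance (hQz : (-Qz).PosDef) (hrz : 0 < rz)
    {P : Matrix (Obs n q) (Obs n q) ℝ} (hP : P.PosDef) {ν : ℝ} (hν : 0 < ν)
    (hinv : (-invarianceMatrix (tQ Qz sz rz) (ts Qz sz rz) (tr Qz sz rz) P ν).PosSemidef)
    {z : Obs n q → ℝ} (hz : z ⬝ᵥ (P⁻¹ *ᵥ z) ≤ 1) : 0 ≤ formZ Qz sz rz z := by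
  by_contra! hneg
  -- With Z = `matZ Qz sz rz`, the vector (y, t) is Z applied to π(0,1) - θ(z,1), the scaled part of
  -- (0,1) that is Z-orthogonal to (z,1). Hence zᵀy + t = 0, and the Z⁻¹-form at (y, t) is r_z π² -
  -- πθ², positive if π < 0. But (2) at (t, -y) bounds ν times this by t² - yᵀPy, which is
  -- nonpositive since t² = (zᵀy)² ≤ yᵀPy.
  set π := formZ Qz sz rz z with hπ
  set θ := sz ⬝ᵥ z + rz with hθ
  set y : Obs n q → ℝ := Qz *ᵥ (-θ • z) + (π - θ) • sz with hy
  set t : ℝ := sz ⬝ᵥ (-θ • z) + rz * (π - θ) with ht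
  have hform : ∀ (a : Obs n q → ℝ) (c : ℝ),
      a ⬝ᵥ (tQ Qz sz rz *ᵥ a) + 2 * (c * (ts Qz sz rz ⬝ᵥ a)) + tr Qz sz rz * c ^ 2 =
      Sum.elim a (fun _ : Unit => c) ⬝ᵥ (invZ Qz sz rz *ᵥ Sum.elim a (fun _ => c)) := by
    intro a c
    rw [invZ_eq_symBlocks hQz, dotProduct_symBlocks_mulVec, replicateCol_mulVec_const,
      of_const_mulVec_const, const_dotProduct_const, dotProduct_smul, smul_eq_mul,
      dotProduct_comm a (ts Qz sz rz)]
    ring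
  have h1 : y ⬝ᵥ (tQ Qz sz rz *ᵥ y) + 2 * (t * (ts Qz sz rz ⬝ᵥ y)) + tr Qz sz rz * t ^ 2 =
      rz * π ^ 2 - π * θ ^ 2 := by
    have hZk := matZ_mulVec (Qz := Qz) (sz := sz) (rz := rz) (-θ • z) (π - θ)
    rw [hform, ← hZk, Matrix.mulVec_mulVec, show invZ Qz sz rz * matZ Qz sz rz = 1 from
      Matrix.nonsing_inv_mul _ ((Matrix.isUnit_iff_isUnit_det _).1 (isUnit_matZ hQz hrz)),
      Matrix.one_mulVec, hZk, sumElim_dotProduct_sumElim, const_dotProduct_const]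
    simp only [Matrix.mulVec_smul, add_dotProduct, smul_dotProduct, dotProduct_smul, smul_eq_mul,
      dotProduct_comm (Qz *ᵥ z) z]
    rw [formZ] at hπ
    linear_combination (-θ ^ 2) * hπ + (2 * π * θ) * hθ
  have h2 : z ⬝ᵥ y + t = 0 := by
    simp only [hy, ht, Matrix.mulVec_smul, dotProduct_add, dotProduct_smul, smul_eq_mul,
      dotProduct_comm z sz]
    simp only [formZ] at hπ
    linear_combination θ * hπ - π * hθ
  have h3 := dotProduct_mulVec_nonneg_of_posSemidef hinv (Sum.elim (fun _ => t) (-y))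
  rw [Matrix.neg_mulVec, dotProduct_neg, invarianceMatrix, dotProduct_symBlocks_mulVec] at h3
  have h4 := sq_dotProduct_le hP hz y
  have h5 : (z ⬝ᵥ y) ^ 2 = t ^ 2 := by
    rw [show z ⬝ᵥ y = -t by linarith]; ring
  have h6 : 0 < rz * π ^ 2 - π * θ ^ 2 := by
    have := mul_pos hrz (pow_pos (neg_pos.2 hneg) 2)
    nlinarith [mul_nonneg (neg_pos.2 hneg).le (sq_nonneg θ)]
  simp only [of_const_mulVec_const, const_dotProduct_const, Matrix.neg_mulVec, Matrix.add_mulVec,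
    Matrix.smul_mulVec, replicateRow_mulVec, Matrix.mulVec_neg, dotProduct_neg, neg_dotProduct,
    dotProduct_add, dotProduct_smul, smul_eq_mul, neg_neg] at h3
  nlinarith [mul_pos hν h6]

end LiftedSet

/-! ### Consequences of the stability condition -/

section Decrease

variable {n m q : ℕ} {Qz : Matrix (Obs n q) (Obs n q) ℝ} {sz : Obs n q → ℝ} {rz : ℝ}

lemma inv_mulVec_dotProduct_nonneg {ι : Type*} [Fintype ι] [DecidableEq ι] {P : Matrix ι ι ℝ}
    (hP : P.PosDef) (z : ι → ℝ) : 0 ≤ (P⁻¹ *ᵥ z) ⬝ᵥ z := by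
  rw [dotProduct_comm]
  exact dotProduct_mulVec_nonneg_of_posSemidef hP.inv.posSemidef z

/-- The stability condition makes the feedback well defined on the set of lifted states. -/
lemma isUnit_controllerMatrix (S : Surrogate n m q) {c_x c_u τ : ℝ}
    (hQz : (-Qz).PosDef) (hrz : 0 < rz)
    {P : Matrix (Obs n q) (Obs n q) ℝ} {L : Matrix (Fin m) (Obs n q) ℝ}
    {Lw : Matrix (Fin m) (Fin m × Obs n q) ℝ} {Lam : Matrix (Fin m) (Fin m) ℝ}
    (hLam : Lam.PosDef)
    (hstab : (stabilityMatrix S c_x c_u (tQ Qz sz rz) (ts Qz sz rz) (tr Qz sz rz)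
      P L Lw Lam τ).PosDef)
    (φ : Fin q → E n → ℝ) (x : E n) (hform : 0 ≤ formZ Qz sz rz (liftHat φ x)) :
    IsUnit (controllerMatrix φ Lw Lam x) := by
  rw [← Matrix.mulVec_injective_iff_isUnit, ← Matrix.coe_mulVecLin,
    injective_iff_map_eq_zero]
  intro u hu
  set z := liftHat φ x with hz
  set lam := Lam⁻¹ *ᵥ u with hlam
  have hLl : Lam *ᵥ lam = u := mulVec_inv_mulVec hLam u
  have hu' : Lw *ᵥ vecKron lam z = u := by
    rw [Matrix.coe_mulVecLin, controllerMatrix, Matrix.sub_mulVec, Matrix.one_mulVec,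
      ← Matrix.mulVec_mulVec, kronCol_mulVec, sub_eq_zero] at hu
    exact hu.symm
  have h := dotProduct_stabilityMatrix_mulVec S c_x c_u (tQ Qz sz rz) (ts Qz sz rz) (tr Qz sz rz)
    P L Lw Lam τ 0 0 0 z 0 lam u (rz + sz ⬝ᵥ z) hLl (by rw [Matrix.mulVec_zero, zero_add, hu'])
    _ rfl
  rw [multiplier_eq_neg_formZ hQz hrz z _ rfl] at h
  by_contra hne
  have hlam0 : lam ≠ 0 := by
    intro h0
    rw [h0, Matrix.mulVec_zero] at hLl
    exact hne hLl.symm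
  obtain ⟨i, hi⟩ := Function.ne_iff.1 hlam0
  -- Were this vector zero with λ ≠ 0, then r_z + s_zᵀz = 0, hence z = 0 from the last block, hence
  -- r_z = 0.
  have hpos := hstab.dotProduct_mulVec_pos (x := Sum.elim 0 (Sum.elim ((rz + sz ⬝ᵥ z) • lam)
    (Sum.elim (Sum.elim 0 0) (Sum.elim (-0)
      (vecKron lam ((rz + sz ⬝ᵥ z) • ts Qz sz rz - z)))))) (by
    intro h0
    have h1 : (rz + sz ⬝ᵥ z) * lam i = 0 := congrFun h0 (Sum.inr (Sum.inl i))
    have h2 : rz + sz ⬝ᵥ z = 0 := (mul_eq_zero.1 h1).resolve_right hi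
    have hz0 : z = 0 := by
      ext l
      have h3 : lam i * ((rz + sz ⬝ᵥ z) * ts Qz sz rz l - z l) = 0 :=
        congrFun h0 (Sum.inr (Sum.inr (Sum.inr (Sum.inr (i, l)))))
      rw [h2, zero_mul, zero_sub] at h3
      simpa using (mul_eq_zero.1 h3).resolve_left hi
    rw [hz0, dotProduct_zero, add_zero] at h2
    exact hrz.ne' h2)
  rw [star_trivial, h] at hpos
  simp only [zero_dotProduct, dotProduct_zero, Matrix.mulVec_zero] at hpos
  have := mul_nonneg (inv_mulVec_dotProduct_nonneg hLam u) hform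
  rw [← hlam] at this
  linarith

/-- Decrease of the Lyapunov function `z ↦ zᵀ P⁻¹ z` along the perturbed bilinear system. -/
lemma lyapunov_decrease (S : Surrogate n m q) {c_x c_u τ ε : ℝ}
    (hQz : (-Qz).PosDef) (hrz : 0 < rz) (hτ : 0 < τ) (hε : 0 ≤ ε)
    {P : Matrix (Obs n q) (Obs n q) ℝ} {L : Matrix (Fin m) (Obs n q) ℝ}
    {Lw : Matrix (Fin m) (Fin m × Obs n q) ℝ} {Lam : Matrix (Fin m) (Fin m) ℝ}
    (hP : P.PosDef) (hLam : Lam.PosDef)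
    (hstab : ∀ v, ε * ‖v‖ ^ 2 ≤ v ⬝ᵥ (stabilityMatrix S c_x c_u (tQ Qz sz rz) (ts Qz sz rz)
      (tr Qz sz rz) P L Lw Lam τ *ᵥ v))
    {z zp e : Obs n q → ℝ} {u : Fin m → ℝ} (hform : 0 ≤ formZ Qz sz rz z)
    (hu : L *ᵥ (P⁻¹ *ᵥ z) + Lw *ᵥ vecKron (Lam⁻¹ *ᵥ u) z = u)
    (hzp : S.A *ᵥ z + S.B₀ *ᵥ u + S.Btilde *ᵥ vecKron u z = zp - e)
    (he : e ⬝ᵥ e ≤ 2 * c_x ^ 2 * (z ⬝ᵥ z) + 2 * c_u ^ 2 * (u ⬝ᵥ u)) :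
    zp ⬝ᵥ (P⁻¹ *ᵥ zp) + ε * ‖P⁻¹ *ᵥ z‖ ^ 2 ≤ z ⬝ᵥ (P⁻¹ *ᵥ z) := by
  set lam := Lam⁻¹ *ᵥ u with hlam
  set p := P⁻¹ *ᵥ zp with hp
  set k := P⁻¹ *ᵥ z with hk
  have hLl : Lam *ᵥ lam = u := mulVec_inv_mulVec hLam u
  have hPp : P *ᵥ p = zp := mulVec_inv_mulVec hP zp
  have hPk : P *ᵥ k = z := mulVec_inv_mulVec hP z
  -- The scalings 2c_x²/τ and 2c_u²/τ minimize the form over the third block. Its quadratic part is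
  -- then half of the linear part, leaving -τ⁻¹(2c_x²|z|² + 2c_u²|u|²), exactly enough to absorb the
  -- error.
  set v : Obs n q ⊕ (Fin m ⊕ ((Obs n q ⊕ Fin m) ⊕ (Obs n q ⊕ (Fin m × Obs n q)))) → ℝ :=
    Sum.elim p (Sum.elim ((rz + sz ⬝ᵥ z) • lam)
      (Sum.elim (Sum.elim ((2 * c_x ^ 2 / τ) • z) ((2 * c_u ^ 2 / τ) • u))
        (Sum.elim (-k) (vecKron lam ((rz + sz ⬝ᵥ z) • ts Qz sz rz - z))))) with hv
  have h := dotProduct_stabilityMatrix_mulVec S c_x c_u (tQ Qz sz rz) (ts Qz sz rz) (tr Qz sz rz)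
    P L Lw Lam τ p ((2 * c_x ^ 2 / τ) • z) k z ((2 * c_u ^ 2 / τ) • u) lam u (rz + sz ⬝ᵥ z)
    hLl hu v hv
  rw [multiplier_eq_neg_formZ hQz hrz z _ rfl, hPp, hPk, hzp] at h
  have hkv : ‖k‖ ≤ ‖v‖ := by
    refine (pi_norm_le_iff_of_nonneg (norm_nonneg v)).2 fun l => ?_
    have := norm_le_pi_norm v (Sum.inr (Sum.inr (Sum.inr (Sum.inl l))))
    rwa [hv, Sum.elim_inr, Sum.elim_inr, Sum.elim_inr, Sum.elim_inl, Pi.neg_apply, norm_neg,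
      ← hv] at this
  have h1 : ε * ‖k‖ ^ 2 ≤ ε * ‖v‖ ^ 2 :=
    mul_le_mul_of_nonneg_left (pow_le_pow_left₀ (norm_nonneg k) hkv 2) hε
  have h2 := mul_nonneg (inv_mulVec_dotProduct_nonneg hLam u) hform
  rw [← hlam] at h2
  -- Completing the square: the term -τ|p|² from the first block absorbs the cross term 2pᵀe at the
  -- cost of τ⁻¹|e|².
  have h3 : 0 ≤ (e - τ • p) ⬝ᵥ (e - τ • p) := by
    simpa using dotProduct_star_self_nonneg (e - τ • p)
  simp only [dotProduct_sub, sub_dotProduct, dotProduct_smul, smul_dotProduct, smul_eq_mul,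
    dotProduct_comm e p] at h3
  have h4 : 2 * (p ⬝ᵥ e) - τ * (p ⬝ᵥ p) ≤ τ⁻¹ * (e ⬝ᵥ e) := by
    rw [inv_mul_eq_div, le_div_iff₀ hτ]
    linarith
  have h5 := mul_le_mul_of_nonneg_left he (inv_pos.2 hτ).le
  have h6 : τ / 2 * ((c_x ^ 2)⁻¹ * ((2 * c_x ^ 2 / τ) • z ⬝ᵥ (2 * c_x ^ 2 / τ) • z) +
      (c_u ^ 2)⁻¹ * ((2 * c_u ^ 2 / τ) • u ⬝ᵥ (2 * c_u ^ 2 / τ) • u)) =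
      τ⁻¹ * (2 * c_x ^ 2 * (z ⬝ᵥ z) + 2 * c_u ^ 2 * (u ⬝ᵥ u)) := by
    simp only [dotProduct_smul, smul_dotProduct, smul_eq_mul]
    field_simp
  have h7 : 2 * ((2 * c_x ^ 2 / τ) • z ⬝ᵥ z) + 2 * ((2 * c_u ^ 2 / τ) • u ⬝ᵥ u) =
      2 * (τ⁻¹ * (2 * c_x ^ 2 * (z ⬝ᵥ z) + 2 * c_u ^ 2 * (u ⬝ᵥ u))) := by
    simp only [smul_dotProduct, smul_eq_mul]
    field_simp
  have h8 := hstab v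
  rw [h, h6] at h8
  rw [dotProduct_sub, dotProduct_comm p zp, dotProduct_comm k z] at h8
  rw [dotProduct_comm p zp] at *
  linarith

end Decrease

/-! ### The bilinear surrogate -/

section Prediction

variable {n m q : ℕ}

lemma B₀_mulVec (S : Surrogate n m q) (u : Fin m → ℝ) (l : Obs n q) :
    (S.B₀ *ᵥ u) l = ∑ i, u i * S.b₀ i l := by
  simp [Surrogate.B₀, Matrix.mulVec, dotProduct, mul_comm]

lemma Btilde_mulVec_vecKron (S : Surrogate n m q) (u : Fin m → ℝ) (z : Obs n q → ℝ)
    (l : Obs n q) :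
    (S.Btilde *ᵥ vecKron u z) l = ∑ i, u i * ((S.Bhat i - S.A) *ᵥ z) l := by
  simp only [Surrogate.Btilde, Matrix.mulVec, dotProduct, vecKron, Fintype.sum_prod_type,
    Matrix.of_apply, Finset.mul_sum]
  exact Finset.sum_congr rfl fun _ _ => Finset.sum_congr rfl fun _ _ => by ring

lemma Kᵢ_sub_K₀ (S : Surrogate n m q) (i : Fin m) :
    S.Kᵢ i - S.K₀ =
      Matrix.fromBlocks 0 0 (Matrix.replicateCol Unit (S.b₀ i)) (S.Bhat i - S.A) := by
  rw [Surrogate.Kᵢ, Surrogate.K₀, sub_eq_add_neg, Matrix.fromBlocks_neg, Matrix.fromBlocks_add]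
  simp [sub_eq_add_neg]

/-- The differences Kᵢ - K₀ have zero first row, so the constant observable is propagated without
error and only the reduced coordinates matter. -/
lemma K_mulVec_lift (S : Surrogate n m q) (u : E m) (φ : Fin q → E n → ℝ) (x : E n) :
    S.K u *ᵥ lift φ x = Sum.elim (fun _ => 1)
      (S.A *ᵥ liftHat φ x + S.B₀ *ᵥ u.ofLp + S.Btilde *ᵥ vecKron u.ofLp (liftHat φ x)) := by
  have h1 : lift φ x = Sum.elim (fun _ : Unit => (1 : ℝ)) (liftHat φ x) := rfl
  rw [Surrogate.K, Matrix.add_mulVec, Matrix.sum_mulVec, h1]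
  simp only [Kᵢ_sub_K₀, Matrix.smul_mulVec, Matrix.fromBlocks_mulVec, Sum.elim_comp_inl,
    Sum.elim_comp_inr, replicateCol_mulVec_const, Matrix.zero_mulVec]
  simp only [Surrogate.K₀, Matrix.fromBlocks_mulVec, Sum.elim_comp_inl, Sum.elim_comp_inr,
    Matrix.zero_mulVec, Matrix.one_mulVec]
  ext (l | l)
  · simp
  · simp only [Pi.add_apply, Finset.sum_apply, Pi.smul_apply, Sum.elim_inr, smul_eq_mul,
      B₀_mulVec, Btilde_mulVec_vecKron, add_assoc, ← Finset.sum_add_distrib, mul_add,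
      zero_add, one_mul]

lemma lift_sub_lift_zero {φ : Fin q → E n → ℝ} (hφ0 : ∀ j, φ j 0 = 0) (x : E n) :
    lift φ x - lift φ 0 = Sum.elim (fun _ => 0) (liftHat φ x) := by
  ext (l | l | l) <;> simp [lift, liftHat, hφ0]

lemma sum_elim_zero_dotProduct {ι : Type*} [Fintype ι] (v : ι → ℝ) :
    Sum.elim (fun _ : Unit => (0 : ℝ)) v ⬝ᵥ Sum.elim (fun _ => 0) v = v ⬝ᵥ v := by
  rw [sumElim_dotProduct_sumElim, const_dotProduct_const]
  ring

/-- The one-step prediction error in the reduced coordinates. -/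
lemma prediction_error {f : E n → E n} {g : Fin m → E n → E n} {T : ℝ} {φ : Fin q → E n → ℝ}
    {X : Set (E n)} {U : Set (E m)} {c_x c_u : ℝ} {S : Surrogate n m q}
    (hφ0 : ∀ j, φ j 0 = 0)
    (hS : ErrorBound f g T φ X U c_x c_u S) {x : E n} (hx : x ∈ X) {u : E m} (hu : u ∈ U)
    {e : Obs n q → ℝ}
    (he : e = liftHat φ (flow f g T x u) - (S.A *ᵥ liftHat φ x + S.B₀ *ᵥ u.ofLp +
      S.Btilde *ᵥ vecKron u.ofLp (liftHat φ x))) :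
    e ⬝ᵥ e ≤ 2 * c_x ^ 2 * (liftHat φ x ⬝ᵥ liftHat φ x) + 2 * c_u ^ 2 * (u.ofLp ⬝ᵥ u.ofLp) := by
  have h := hS x hx u hu
  rw [lift_sub_lift_zero hφ0, K_mulVec_lift] at h
  have h1 : (fun l => koopman f g T u (fun y => lift φ y l) x) - Sum.elim (fun _ => 1)
      (S.A *ᵥ liftHat φ x + S.B₀ *ᵥ u.ofLp + S.Btilde *ᵥ vecKron u.ofLp (liftHat φ x)) =
      Sum.elim (fun _ => 0) e := by
    subst he
    ext (l | l)
    · simp [koopman, lift]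
    · rfl
  rw [h1] at h
  have h2 : ∀ v : Obs n q → ℝ, l2norm (Sum.elim (fun _ : Unit => (0 : ℝ)) v) ^ 2 = v ⬝ᵥ v :=
    fun v => by rw [l2norm_sq, sum_elim_zero_dotProduct]
  have h3 : ‖u‖ ^ 2 = u.ofLp ⬝ᵥ u.ofLp := l2norm_sq u.ofLp
  rw [← h2 e, ← h2 (liftHat φ x), ← h3]
  have h4 := pow_le_pow_left₀ (norm_nonneg _) h 2
  refine h4.trans ?_
  -- (a + b)² ≤ 2a² + 2b²; this factor 2 is matched by τ/2 in the third diagonal block of (1).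
  nlinarith [sq_nonneg (c_x * l2norm (Sum.elim (fun _ : Unit => (0 : ℝ)) (liftHat φ x)) -
    c_u * ‖u‖)]

end Prediction

/-! ### Bounds on the observables -/

section Observables

variable {n q : ℕ}

/-- `C¹` observables vanishing at the origin are linearly bounded on compact sets. -/
lemma exists_norm_liftHat_le {φ : Fin q → E n → ℝ} (hφ : ∀ j, ContDiff ℝ 1 (φ j))
    (hφ0 : ∀ j, φ j 0 = 0) {X : Set (E n)} (hX : IsCompact X) :
    ∃ c > 0, ∀ x ∈ X, ‖liftHat φ x‖ ≤ c * ‖x‖ := by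
  -- X need be neither convex nor contain 0; the mean value inequality is applied on a ball around 0
  -- instead.
  obtain ⟨R, hR⟩ := hX.isBounded.subset_closedBall (0 : E n)
  have hj : ∀ j, ∃ c : ℝ, ∀ x ∈ Metric.closedBall (0 : E n) R, ‖φ j x‖ ≤ c * ‖x‖ := by
    intro j
    obtain ⟨c, hc⟩ := (isCompact_closedBall (0 : E n) R).exists_bound_of_continuousOn
      ((hφ j).continuous_fderiv one_ne_zero).continuousOn
    refine ⟨c, fun x hx => ?_⟩
    have h0 : (0 : E n) ∈ Metric.closedBall (0 : E n) R :=
      Metric.mem_closedBall_self (dist_nonneg.trans hx)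
    have := (convex_closedBall (0 : E n) R).norm_image_sub_le_of_norm_fderiv_le (𝕜 := ℝ)
      (fun y _ => (hφ j).differentiable one_ne_zero y) hc h0 hx
    simpa [hφ0] using this
  choose c hc using hj
  refine ⟨1 + ∑ j, |c j|, by positivity, fun x hx => ?_⟩
  have hs : 0 ≤ ∑ j, |c j| := by positivity
  refine (pi_norm_le_iff_of_nonneg (by positivity)).2 ?_
  rintro (i | j)
  · refine (PiLp.norm_apply_le x i).trans ?_
    nlinarith [norm_nonneg x]
  · refine (hc j x (hR hx)).trans (mul_le_mul_of_nonneg_right ?_ (norm_nonneg x))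
    have := Finset.single_le_sum (f := fun j => |c j|) (fun j _ => abs_nonneg _)
      (Finset.mem_univ j)
    linarith [le_abs_self (c j)]

lemma sq_norm_le_dotProduct_liftHat (φ : Fin q → E n → ℝ) (x : E n) :
    ‖x‖ ^ 2 ≤ liftHat φ x ⬝ᵥ liftHat φ x := by
  rw [EuclideanSpace.norm_sq_eq, liftHat, sumElim_dotProduct_sumElim]
  have : ∑ i, ‖x i‖ ^ 2 = (fun i => x i) ⬝ᵥ (fun i => x i) := by simp [dotProduct, pow_two]
  rw [this]
  have h : 0 ≤ (fun j => φ j x) ⬝ᵥ (fun j => φ j x) :=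
    Finset.sum_nonneg fun j _ => mul_self_nonneg _
  linarith

end Observables

/-! ### The sampled system -/

section Sampled

variable {n m : ℕ} {f : E n → E n} {g : Fin m → E n → E n} {T : ℝ}

/-- `flow` is the endpoint of an arbitrarily chosen solution; uniqueness makes every solution end
there. -/
lemma WellPosed.eq_flow {u : E m} {x : E n} (h : WellPosed f g u T x) (hT : 0 < T)
    {ξ : ℝ → E n} (hξ : IsSolution f g u T x ξ) : ξ T = flow f g T x u := by
  have hex : ∃ ξ, IsSolution f g u T x ξ := ⟨ξ, hξ⟩
  obtain ⟨η, -, hη⟩ := h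
  have hmem : T ∈ Set.Icc 0 T := ⟨hT.le, le_rfl⟩
  rw [flow, dif_pos hex, hη _ hξ hmem, hη _ hex.choose_spec hmem]

/-- Exponential stability from a Lyapunov function with quadratic bounds. -/
lemma sampledExpStableOn_of_lyapunov {μ : E n → E m} {R : Set (E n)} (hT : 0 < T)
    (hwp : ∀ x ∈ R, WellPosed f g (μ x) T x) (V : E n → ℝ) {a b ρ : ℝ} (ha : 0 < a) (hb : 0 < b)
    (hρ0 : 0 < ρ) (hρ1 : ρ < 1) (hlow : ∀ x ∈ R, a * ‖x‖ ^ 2 ≤ V x)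
    (hup : ∀ x ∈ R, V x ≤ b * ‖x‖ ^ 2)
    (hR : ∀ x ∈ R, flow f g T x (μ x) ∈ R)
    (hdec : ∀ x ∈ R, V (flow f g T x (μ x)) ≤ ρ * V x) :
    SampledExpStableOn f g T μ R := by
  -- Square roots of the constants in a‖x_k‖² ≤ ρᵏ b‖x₀‖²; the maximum secures C ≥ 1.
  refine ⟨max 1 √(b / a), le_max_left _ _, √ρ, Real.sqrt_pos.2 hρ0,
    (Real.sqrt_lt' one_pos).2 (by simpa using hρ1), fun x₀ hx₀ => ⟨?_, ?_⟩⟩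
  · refine ⟨fun k => (fun x => flow f g T x (μ x))^[k] x₀, rfl, fun k => ?_⟩
    have hk : (fun x => flow f g T x (μ x))^[k] x₀ ∈ R := by
      induction k with
      | zero => exact hx₀
      | succ k ih => rw [Function.iterate_succ_apply']; exact hR _ ih
    obtain ⟨ξ, hξ, -⟩ := hwp _ hk
    refine ⟨ξ, hξ, ?_⟩
    rw [(hwp _ hk).eq_flow hT hξ]
    exact Function.iterate_succ_apply' _ _ _
  · intro x hx0 hx k
    have hmain : x k ∈ R ∧ V (x k) ≤ ρ ^ k * V x₀ := by
      induction k with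
      | zero => simp [hx0, hx₀]
      | succ k ih =>
        obtain ⟨ξ, hξ, hk⟩ := hx k
        rw [(hwp _ ih.1).eq_flow hT hξ] at hk
        rw [hk]
        refine ⟨hR _ ih.1, (hdec _ ih.1).trans ?_⟩
        rw [pow_succ', mul_assoc]
        exact mul_le_mul_of_nonneg_left ih.2 hρ0.le
    have h1 : a * ‖x k‖ ^ 2 ≤ ρ ^ k * (b * ‖x₀‖ ^ 2) :=
      (hlow _ hmain.1).trans (hmain.2.trans
        (mul_le_mul_of_nonneg_left (hup _ hx₀) (pow_pos hρ0 k).le))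
    have h2 : ‖x k‖ ≤ √(b / a) * √ρ ^ k * ‖x₀‖ := by
      refine le_of_sq_le_sq ?_ (by positivity)
      rw [mul_pow, mul_pow, ← pow_mul, mul_comm k 2, pow_mul, Real.sq_sqrt (by positivity),
        Real.sq_sqrt hρ0.le, div_mul_eq_mul_div, div_mul_eq_mul_div, le_div_iff₀ ha]
      linarith
    refine h2.trans ?_
    gcongr
    exact le_max_right _ _

end Sampled

/-! ### The closed loop -/

section ClosedLoop

variable {n m q : ℕ}

/-- Multiplying the feedback law by its controller matrix gives the implicit equation, the form in
which the stability condition sees the input. -/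
lemma controller_fixed_point {φ : Fin q → E n → ℝ}
    (P : Matrix (Obs n q) (Obs n q) ℝ) (L : Matrix (Fin m) (Obs n q) ℝ)
    {Lw : Matrix (Fin m) (Fin m × Obs n q) ℝ} {Lam : Matrix (Fin m) (Fin m) ℝ} {x : E n}
    (h : IsUnit (controllerMatrix φ Lw Lam x)) :
    L *ᵥ (P⁻¹ *ᵥ liftHat φ x) +
      Lw *ᵥ vecKron (Lam⁻¹ *ᵥ (controller φ P L Lw Lam x).ofLp) (liftHat φ x) =
        (controller φ P L Lw Lam x).ofLp := by
  have h1 : controllerMatrix φ Lw Lam x *ᵥ (controller φ P L Lw Lam x).ofLp =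
      L *ᵥ (P⁻¹ *ᵥ liftHat φ x) := by
    rw [controller, Matrix.mulVec_mulVec, Matrix.mulVec_mulVec, Matrix.mul_assoc,
      ← Matrix.mul_assoc, Matrix.mul_nonsing_inv _ ((Matrix.isUnit_iff_isUnit_det _).1 h),
      Matrix.one_mul]
  rw [← h1]
  set u := (controller φ P L Lw Lam x).ofLp
  rw [controllerMatrix, Matrix.sub_mulVec, Matrix.one_mulVec, ← Matrix.mulVec_mulVec,
    kronCol_mulVec]
  exact sub_add_cancel _ _

/-- The conclusion for a surrogate that satisfies the error bound. -/
theorem closedLoop_expStable {f : E n → E n} {g : Fin m → E n → E n} {X : Set (E n)}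
    (hX : IsCompact X) {U : Set (E m)} {T : ℝ} (hT : 0 < T)
    (hflow : ∀ x ∈ X, ∀ u ∈ U, WellPosed f g u T x)
    {φ : Fin q → E n → ℝ} (hφ : ∀ j, ContDiff ℝ 1 (φ j)) (hφ0 : ∀ j, φ j 0 = 0)
    {S : Surrogate n m q} {c_x c_u : ℝ}
    (hS : ErrorBound f g T φ X U c_x c_u S)
    {Qz : Matrix (Obs n q) (Obs n q) ℝ} {sz : Obs n q → ℝ} {rz : ℝ}
    (hQz : (-Qz).PosDef) (hrz : 0 < rz)
    {P : Matrix (Obs n q) (Obs n q) ℝ} {L : Matrix (Fin m) (Obs n q) ℝ}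
    {Lw : Matrix (Fin m) (Fin m × Obs n q) ℝ} {Lam : Matrix (Fin m) (Fin m) ℝ} {ν τ : ℝ}
    (hP : P.PosDef) (hLam : Lam.PosDef) (hν : 0 < ν) (hτ : 0 < τ)
    (hstab : (stabilityMatrix S c_x c_u (tQ Qz sz rz) (ts Qz sz rz) (tr Qz sz rz)
      P L Lw Lam τ).PosDef)
    (hinv : (-invarianceMatrix (tQ Qz sz rz) (ts Qz sz rz) (tr Qz sz rz) P ν).PosSemidef)
    (hRX : RoA φ P ⊆ X) (hRU : ∀ x ∈ RoA φ P, controller φ P L Lw Lam x ∈ U) :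
    (∀ x ∈ RoA φ P, IsUnit (controllerMatrix φ Lw Lam x)) ∧
      SampledExpStableOn f g T (controller φ P L Lw Lam) (RoA φ P) := by
  have hform : ∀ x ∈ RoA φ P, 0 ≤ formZ Qz sz rz (liftHat φ x) := fun x hx =>
    formZ_nonneg_of_invariance hQz hrz hP hν hinv hx
  have hunit : ∀ x ∈ RoA φ P, IsUnit (controllerMatrix φ Lw Lam x) := fun x hx =>
    isUnit_controllerMatrix S hQz hrz hLam hstab φ x (hform x hx)
  refine ⟨hunit, ?_⟩
  obtain ⟨ε, hε, hM⟩ := exists_pos_mul_sq_le _ hstab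
  obtain ⟨C, hC, hPC⟩ := exists_le_mul_sq P
  obtain ⟨a, ha, hVa⟩ := exists_pos_mul_sq_le _ hP.inv
  obtain ⟨b, hb, hVb⟩ := exists_le_mul_sq P⁻¹
  obtain ⟨d, hd, hId⟩ := exists_le_mul_sq (1 : Matrix (Obs n q) (Obs n q) ℝ)
  obtain ⟨c, hc, hΦ⟩ := exists_norm_liftHat_le hφ hφ0 hX
  set V : E n → ℝ := fun x => liftHat φ x ⬝ᵥ (P⁻¹ *ᵥ liftHat φ x) with hV
  have hdec : ∀ x ∈ RoA φ P, V (flow f g T x (controller φ P L Lw Lam x)) +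
      ε * ‖P⁻¹ *ᵥ liftHat φ x‖ ^ 2 ≤ V x := fun x hx =>
    lyapunov_decrease S hQz hrz hτ hε.le hP hLam hM (hform x hx)
      (controller_fixed_point P L (hunit x hx)) (sub_sub_cancel _ _).symm
      (prediction_error hφ0 hS (hRX hx) (hRU x hx) rfl)
  have hV0 : ∀ x, 0 ≤ V x := fun x =>
    dotProduct_mulVec_nonneg_of_posSemidef hP.inv.posSemidef _
  have hVC : ∀ x, V x ≤ C * ‖P⁻¹ *ᵥ liftHat φ x‖ ^ 2 := by
    intro x
    have h := hPC (P⁻¹ *ᵥ liftHat φ x)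
    rwa [mulVec_inv_mulVec hP, dotProduct_comm] at h
  -- Since V ≤ C‖P⁻¹z‖², the decrease contracts V by 1 - ε/C; the maximum with 1/2 keeps the rate
  -- positive.
  refine sampledExpStableOn_of_lyapunov (ρ := max (1 / 2) (1 - ε / C)) hT
    (fun x hx => hflow x (hRX hx) _ (hRU x hx)) V (div_pos ha hd)
    (mul_pos hb (pow_pos hc 2)) (lt_max_of_lt_left one_half_pos)
    (max_lt one_half_lt_one (sub_lt_self 1 (div_pos hε hC))) ?_ ?_ ?_ ?_
  · intro x _
    have h1 := (sq_norm_le_dotProduct_liftHat φ x).trans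
      (by simpa only [Matrix.one_mulVec] using hId (liftHat φ x))
    have h2 := hVa (liftHat φ x)
    calc a / d * ‖x‖ ^ 2 ≤ a / d * (d * ‖liftHat φ x‖ ^ 2) := by gcongr
      _ = a * ‖liftHat φ x‖ ^ 2 := by field_simp
      _ ≤ V x := h2
  · intro x hx
    calc V x ≤ b * ‖liftHat φ x‖ ^ 2 := hVb _
      _ ≤ b * (c * ‖x‖) ^ 2 := by gcongr; exact hΦ x (hRX hx)
      _ = b * c ^ 2 * ‖x‖ ^ 2 := by ring
  · intro x hx
    have h1 : V x ≤ 1 := hx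
    have h2 := hdec x hx
    have h3 : 0 ≤ ε * ‖P⁻¹ *ᵥ liftHat φ x‖ ^ 2 := by positivity
    change V _ ≤ 1
    linarith
  · intro x hx
    have h1 : ε / C * V x ≤ ε * ‖P⁻¹ *ᵥ liftHat φ x‖ ^ 2 := by
      calc ε / C * V x ≤ ε / C * (C * ‖P⁻¹ *ᵥ liftHat φ x‖ ^ 2) := by gcongr; exact hVC x
        _ = _ := by field_simp
    have h2 := hdec x hx
    calc V _ ≤ (1 - ε / C) * V x := by linarith
      _ ≤ _ := mul_le_mul_of_nonneg_right (le_max_right _ _) (hV0 x)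

end ClosedLoop

end SafEDMD

theorem mainTheorem3 {n m q : ℕ}
    -- the control system, with an equilibrium at the origin
    (f : E n → E n) (g : Fin m → E n → E n) (hf0 : f 0 = 0)
    -- the state and input sets, and the sampling period
    (X : Set (E n)) (hX : IsCompact X)
    (U : Set (E m)) (hU : IsCompact U) (hU0 : (0 : E m) ∈ interior U)
    (Δt : ℝ) (hΔt : 0 < Δt)
    -- the flow over one sampling period is well defined
    (hflow : ∀ x ∈ X, ∀ u ∈ U ∪ Set.range testInput, WellPosed f g u Δt x)
    -- the observables besides the constant and the state coordinates
    (φ : Fin q → E n → ℝ) (hφ : ∀ j, ContDiff ℝ 1 (φ j)) (hφ0 : ∀ j, φ j 0 = 0)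
    -- the data: for each test input, i.i.d. samples from `X`
    {Ω : Type*} [MeasurableSpace Ω] (Pr : Measure Ω) [IsProbabilityMeasure Pr]
    (ξ : Option (Fin m) → ℕ → Ω → E n)
    (hξ_meas : ∀ v j, Measurable (ξ v j))
    (hξ_indep : ∀ v, iIndepFun (ξ v) Pr)
    (hξ_ident : ∀ v j, IdentDistrib (ξ v j) (ξ v 0) Pr Pr)
    (hξ_mem : ∀ v j, ∀ᵐ ω ∂Pr, ξ v j ω ∈ X)
    -- the surrogate learned from the first `d` samples and their successors
    (S : ℕ → Ω → Surrogate n m q)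
    (hS : ∀ d ω, IsLearned φ (fun v (j : Fin d) => ξ v j ω)
      (fun v (j : Fin d) => flow f g Δt (ξ v j ω) (testInput v)) (S d ω))
    -- the proportional error bound, with probability `1 - δ` for enough data
    (δ : ℝ) (hδ0 : 0 < δ) (hδ1 : δ < 1) (c_x c_u : ℝ) (hcx : 0 < c_x) (hcu : 0 < c_u)
    (herr : ∃ d₁ : ℕ, ∀ d ≥ d₁,
      HoldsWithProb Pr δ fun ω => ErrorBound f g Δt φ X U c_x c_u (S d ω))
    -- the user-defined set of lifted states
    (Qz : Matrix (Obs n q) (Obs n q) ℝ) (sz : Obs n q → ℝ) (rz : ℝ)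
    (hQz : (-Qz).PosDef) (hrz : 0 < rz) :
    ∃ d₀ : ℕ, ∀ d ≥ d₀, HoldsWithProb Pr δ fun ω =>
      ∀ (P : Matrix (Obs n q) (Obs n q) ℝ) (L : Matrix (Fin m) (Obs n q) ℝ)
        (Lw : Matrix (Fin m) (Fin m × Obs n q) ℝ) (Lam : Matrix (Fin m) (Fin m) ℝ) (ν τ : ℝ),
        P.PosDef → Lam.PosDef → 0 < ν → 0 < τ →
        (stabilityMatrix (S d ω) c_x c_u (tQ Qz sz rz) (ts Qz sz rz) (tr Qz sz rz)
          P L Lw Lam τ).PosDef →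
        (-invarianceMatrix (tQ Qz sz rz) (ts Qz sz rz) (tr Qz sz rz) P ν).PosSemidef →
        -- states and inputs stay where the error bound is available
        RoA φ P ⊆ X → (∀ x ∈ RoA φ P, controller φ P L Lw Lam x ∈ U) →
        (∀ x ∈ RoA φ P, IsUnit (controllerMatrix φ Lw Lam x)) ∧
          SampledExpStableOn f g Δt (controller φ P L Lw Lam) (RoA φ P) := by
  obtain ⟨d₁, hd₁⟩ := herr
  -- The event of the error bound serves unchanged: the argument on it is uniform in the design
  -- variables, so these may depend on the sample.
  refine ⟨d₁, fun d hd => ?_⟩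
  obtain ⟨G, hG, hPr, hbound⟩ := hd₁ d hd
  refine ⟨G, hG, hPr, fun ω hω P L Lw Lam ν τ hP hLam hν hτ hstab hinv hRX hRU => ?_⟩
  exact closedLoop_expStable hX hΔt (fun x hx u hu => hflow x hx u (Or.inl hu)) hφ hφ0
    (hbound ω hω) hQz hrz hP hLam hν hτ hstab hinv hRX hRU
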